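/- Let $n\ge 1$, let $H$ be a complex Hilbert space, let $f\in L^1(\mathbb R^n;H)\cap L^2(\mathbb R^n;H)$, and let $$\hat f(\xi)=(2\pi)^{-n/2}\int_{\mathbb R^n}e^{-i x\cdot\xi}f(x)\,dx,\qquad \xi\in\mathbb R^n,$$ be its Fourier transform. (i) (Beurling–Hörmander type uncertainty principle.) If $$\int_{\mathbb R^n}\int_{\mathbb R^n}\|f(x)\|_H\,\|\hat f(\xi)\|_H\,e^{|x\cdot\xi|}\,dx\,d\xi<\infty,$$ then $f=0$ almost everywhere. (ii) (Morgan type uncertainty principle.) Let $p\in(1,2)$, $\frac1p+\frac1q=1$, and $\alpha,\beta>0$ with $\alpha\beta>1$. If $$\int_{\mathbb R^n}\|f(x)\|_H\,e^{\alpha^p|x|^p/p}\,dx+\int_{\mathbb R^n}\|\hat f(\xi)\|_H\,e^{\beta^q|\xi|^q/q}\,d\xi<\infty,$$ then $f=0$ almost everywhere. -/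

import Mathlib

open MeasureTheory

noncomputable section

/-- The unitary Fourier transform in angular frequency of a vector-valued function on `ℝⁿ`,
`f̂(ξ) = (2π)^(-n/2) ∫ e^(-i x·ξ) f(x) dx` (Bochner integral). Mathlib's `𝓕` uses the
kernel `e^(-2πi x·ξ)` instead, which would change the weight `e^|x·ξ|`. -/
def angularFourier {n : ℕ} {H : Type*} [NormedAddCommGroup H] [NormedSpace ℂ H]
    (f : EuclideanSpace ℝ (Fin n) → H) (ξ : EuclideanSpace ℝ (Fin n)) : H :=
  ((2 * Real.pi) ^ (-(n : ℝ) / 2) : ℝ) •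
    ∫ x, Complex.exp (-(Complex.I * (inner ℝ x ξ : ℝ))) • f x

end

/-! Part (ii) reduces to part (i): since αβ > 1, Young's inequality bounds |x·ξ| by α^p|x|^p/p +
β^q|ξ|^q/q, so the double integral is dominated by a product of two finite ones. For (i), pairing
with a vector of H makes f scalar. Restricted to a line ℝv, the Fourier integral is φ(r) = ∫ exp(-i
r l) f with l(x) = ⟨x, v⟩, and by integration in polar form the hypothesis descends to almost every
v, so a one-variable statement suffices (`phase_integral_eq_zero`). There, put h(z) = ∫ f exp(-(z -
l)²/2). It is entire of order two, and up to a constant it is the Fourier integral of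
exp(-r²/2)φ(r), so |h(z)| ≤ M(|Im z|) with M increasing. Completing squares turns the hypothesis
into integrability of |h(s)| M(|s|) on ℝ. The primitive G(z) = ∫₀^z h(u)h(iu) du is then bounded on
both axes: on each, one factor is h at a real point and the other is at most M. Phragmén–Lindelöf in
each quadrant and Liouville make G constant, so h(z)h(iz) = 0 and h = 0
(`entire_eq_zero_of_integrable_mul`). Fourier injectivity gives φ = 0, and once all lines are
covered, f = 0. -/

/-! ### Entire functions: Phragmén–Lindelöf and Liouville -/

/-- The integral of an entire function along the segment from `0` to `z` is a primitive. -/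
theorem hasDerivAt_segment_integral {k : ℂ → ℂ} (hk : Differentiable ℂ k) (z : ℂ) :
    HasDerivAt (fun z : ℂ => ∫ t in (0 : ℝ)..1, k (t * z) * z) (k z) z := by
  obtain ⟨G, hG⟩ := hk.isExactOn_univ
  have key : (fun z : ℂ => ∫ t in (0 : ℝ)..1, k (t * z) * z) = fun z => G z - G 0 := by
    funext w
    have h1 : ∀ t ∈ Set.uIcc (0 : ℝ) 1, HasDerivAt (fun t : ℝ => G (t * w)) (k (t * w) * w) t := by
      intro t _
      have h2 : HasDerivAt (fun t : ℂ => t * w) w (t : ℂ) := by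
        simpa using (hasDerivAt_id (t : ℂ)).mul_const w
      exact ((hG (t * w) (Set.mem_univ _)).comp (t : ℂ) h2).comp_ofReal
    rw [intervalIntegral.integral_eq_sub_of_hasDerivAt h1]
    · simp
    · apply Continuous.intervalIntegrable
      have := hk.continuous
      fun_prop
  rw [key]
  exact (hG z (Set.mem_univ _)).sub_const _

/-- The substitution u = s t makes this an integral over [0, s] along the ray through e, giving a
bound independent of s. -/
theorem norm_segment_integral_le {k : ℂ → ℂ} {g : ℝ → ℝ} (hg : Integrable g)
    (hg0 : ∀ u, 0 ≤ g u) {e : ℂ} (he : ‖e‖ = 1) (hkg : ∀ u : ℝ, 0 ≤ u → ‖k (u * e)‖ ≤ g u)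
    {s : ℝ} (hs : 0 ≤ s) :
    ‖∫ t in (0 : ℝ)..1, k (t * (s * e)) * (s * e)‖ ≤ ∫ u, g u := by
  have h1 : ∫ t in (0 : ℝ)..1, k (t * (s * e)) * (s * e) = ∫ u in (0 : ℝ)..s, k (u * e) * e := by
    have := intervalIntegral.smul_integral_comp_mul_left (a := 0) (b := 1)
      (fun u : ℝ => k (u * e) * e) s
    simp only [mul_zero, mul_one] at this
    rw [← this, ← intervalIntegral.integral_smul]
    congr 1
    funext t
    rw [Complex.real_smul]
    push_cast
    rw [show (t : ℂ) * (s * e) = s * t * e by ring]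
    ring
  rw [h1]
  calc ‖∫ u in (0 : ℝ)..s, k (u * e) * e‖ ≤ ∫ u in (0 : ℝ)..s, g u := by
        refine intervalIntegral.norm_integral_le_of_norm_le hs ?_ hg.intervalIntegrable
        refine Filter.Eventually.of_forall fun u hu => ?_
        rw [norm_mul, he, mul_one]
        exact hkg u hu.1.le
    _ = ∫ u in Set.Ioc 0 s, g u := intervalIntegral.integral_of_le hs
    _ ≤ ∫ u, g u := setIntegral_le_integral hg (Filter.Eventually.of_forall hg0)

theorem le_exp_sq (x : ℝ) : x ≤ Real.exp (x ^ 2) := by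
  nlinarith [Real.add_one_le_exp (x ^ 2), sq_nonneg (x - 1)]

theorem norm_segment_integral_le_exp {k : ℂ → ℂ} {C : ℝ}
    (hC : ∀ z, ‖k z‖ ≤ C * Real.exp (2 * ‖z‖ ^ 2)) (z : ℂ) :
    ‖∫ t in (0 : ℝ)..1, k (t * z) * z‖ ≤ C * Real.exp (3 * ‖z‖ ^ 2) := by
  have hC0 : 0 ≤ C := by simpa using (norm_nonneg _).trans (hC 0)
  have h := intervalIntegral.norm_integral_le_of_norm_le_const (a := 0) (b := 1)
    (f := fun t : ℝ => k (t * z) * z) (C := C * Real.exp (3 * ‖z‖ ^ 2)) ?_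
  · simpa using h
  · intro t ht
    rw [Set.uIoc_of_le zero_le_one] at ht
    have h1 : ‖(t : ℂ) * z‖ ≤ ‖z‖ := by
      rw [norm_mul, Complex.norm_real, Real.norm_of_nonneg ht.1.le]
      exact mul_le_of_le_one_left (norm_nonneg _) ht.2
    -- The factor ‖z‖ is absorbed by exp(‖z‖²), which raises the exponent from 2 to 3.
    calc ‖k (t * z) * z‖ = ‖k (t * z)‖ * ‖z‖ := norm_mul _ _
      _ ≤ (C * Real.exp (2 * ‖z‖ ^ 2)) * Real.exp (‖z‖ ^ 2) := by
          gcongr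
          · exact (hC _).trans (by gcongr)
          · exact le_exp_sq _
      _ = C * Real.exp (3 * ‖z‖ ^ 2) := by
          rw [mul_assoc, ← Real.exp_add]; ring_nf

/-- The Phragmén–Lindelöf principle, for functions of order two, in the sector
`a ≤ arg z ≤ π / 2` with `a > 0`. -/
theorem norm_le_of_sector {G : ℂ → ℂ} (hG : Differentiable ℂ G) {C B a : ℝ} (ha : 0 < a)
    (ha' : a < Real.pi / 2)
    (hgrowth : ∀ z, ‖G z‖ ≤ C * Real.exp (3 * ‖z‖ ^ 2))
    (hlow : ∀ s : ℝ, 0 ≤ s → ‖G (s * Complex.exp (a * Complex.I))‖ ≤ B)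
    (hup : ∀ s : ℝ, 0 ≤ s → ‖G (s * Complex.I)‖ ≤ B)
    {z : ℂ} (hz : z ≠ 0) (hza : a ≤ z.arg) (hzb : z.arg ≤ Real.pi / 2) : ‖G z‖ ≤ B := by
  have hexp : ∀ w : ℂ, Complex.exp w = (Real.exp w.re : ℝ) * Complex.exp (w.im * Complex.I) := by
    intro w
    rw [Complex.ofReal_exp, ← Complex.exp_add, Complex.re_add_im]
  have hC0 : 0 ≤ C := by simpa using (norm_nonneg _).trans (hgrowth 0)
  have key := PhragmenLindelof.horizontal_strip (a := a) (b := Real.pi / 2) (C := B)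
    (f := fun w => G (Complex.exp w)) (z := Complex.log z) ?_ ?_ ?_ ?_ ?_ ?_
  · simpa [Complex.exp_log hz] using key
  · exact (hG.comp Complex.differentiable_exp).diffContOnCl
  -- In the coordinate log z the sector is a strip of width π/2 - a, which admits growth exp(3
  -- exp(c|Re w|)) for c < π/(π/2 - a). The value c = 2 is admissible exactly because a > 0.
  · refine ⟨2, ?_, 3, ?_⟩
    · rw [lt_div_iff₀ (by linarith)]
      linarith
    · refine Asymptotics.IsBigO.of_bound C (Filter.Eventually.of_forall fun w => ?_)
      refine (hgrowth _).trans ?_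
      rw [Real.norm_of_nonneg (Real.exp_pos _).le, Complex.norm_exp, ← Real.exp_nat_mul]
      have := le_abs_self w.re
      push_cast
      gcongr
  · intro w hw
    rw [hexp w, hw]
    exact hlow _ (Real.exp_pos _).le
  · intro w hw
    rw [hexp w, hw]
    have : Complex.exp ((Real.pi / 2 : ℝ) * Complex.I) = Complex.I := by
      push_cast; exact Complex.exp_pi_div_two_mul_I
    rw [this]
    exact hup _ (Real.exp_pos _).le
  · rwa [Complex.log_im]
  · rwa [Complex.log_im]

/-- Order two is the critical order for a quadrant, so Phragmén–Lindelöf does not apply directly.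
Rotating the argument of h₁ by -a keeps the primitive bounded by B on the rays arg z = a and arg z =
π/2, whose sector is strictly narrower; then a → 0. -/
theorem norm_segment_integral_mul_le_of_quadrant {h₁ h₂ : ℂ → ℂ} (hd₁ : Differentiable ℂ h₁)
    (hd₂ : Differentiable ℂ h₂) {C : ℝ} (hC₁ : ∀ z, ‖h₁ z‖ ≤ C * Real.exp (‖z‖ ^ 2))
    (hC₂ : ∀ z, ‖h₂ z‖ ≤ C * Real.exp (‖z‖ ^ 2)) {M : ℝ → ℝ} (hM : MonotoneOn M (Set.Ici 0))
    (hM₁ : ∀ z, ‖h₁ z‖ ≤ M |z.im|) (hM₂ : ∀ z, ‖h₂ z‖ ≤ M |z.im|)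
    (hi₁ : Integrable fun s : ℝ => ‖h₁ s‖ * M |s|)
    (hi₂ : Integrable fun s : ℝ => ‖h₂ (-s)‖ * M |s|)
    {B : ℝ} (hB₁ : ∫ s : ℝ, ‖h₁ s‖ * M |s| ≤ B) (hB₂ : ∫ s : ℝ, ‖h₂ (-s)‖ * M |s| ≤ B)
    {z : ℂ} (hre : 0 ≤ z.re) (him : 0 ≤ z.im) :
    ‖∫ t in (0 : ℝ)..1, h₁ (t * z) * h₂ (Complex.I * (t * z)) * z‖ ≤ B := by
  have hM0 : ∀ s : ℝ, 0 ≤ M |s| := fun s => by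
    have := (norm_nonneg _).trans (hM₁ (s * Complex.I))
    simpa using this
  have hC0 : 0 ≤ C := by simpa using (norm_nonneg _).trans (hC₁ 0)
  -- On the ray of argument a the rotated h₁ is evaluated at a real point, and h₂ is at most M of
  -- the modulus.
  have hlow : ∀ a s : ℝ, 0 ≤ s →
      ‖∫ t in (0 : ℝ)..1, h₁ (Complex.exp (-(a * Complex.I)) * (t * (s * Complex.exp (a * Complex.I))))
        * h₂ (Complex.I * (t * (s * Complex.exp (a * Complex.I)))) *
        (s * Complex.exp (a * Complex.I))‖ ≤ B := by
    intro a s hs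
    refine le_trans (norm_segment_integral_le (e := Complex.exp (a * Complex.I)) (s := s)
      (k := fun u => h₁ (Complex.exp (-(a * Complex.I)) * u) * h₂ (Complex.I * u))
      hi₁ ?_ ?_ ?_ hs) hB₁
    · exact fun u => mul_nonneg (norm_nonneg _) (hM0 u)
    · exact Complex.norm_exp_ofReal_mul_I a
    · intro u hu
      have h1 : Complex.exp (-(a * Complex.I)) * (u * Complex.exp (a * Complex.I)) = u := by
        rw [mul_left_comm, ← Complex.exp_add]; simp
      rw [h1, norm_mul]
      gcongr
      refine (hM₂ _).trans (hM (Set.mem_Ici.2 (abs_nonneg _)) (Set.mem_Ici.2 (abs_nonneg _)) ?_)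
      refine (Complex.abs_im_le_norm _).trans ?_
      rw [norm_mul, norm_mul, Complex.norm_exp_ofReal_mul_I]
      simp
  -- On the imaginary ray the roles swap: i(iu) = -u puts h₂ at a real point, and M controls h₁.
  have hup : ∀ a s : ℝ, 0 ≤ s →
      ‖∫ t in (0 : ℝ)..1, h₁ (Complex.exp (-(a * Complex.I)) * (t * (s * Complex.I)))
        * h₂ (Complex.I * (t * (s * Complex.I))) * (s * Complex.I)‖ ≤ B := by
    intro a s hs
    refine le_trans (norm_segment_integral_le (e := Complex.I) (s := s)
      (k := fun u => h₁ (Complex.exp (-(a * Complex.I)) * u) * h₂ (Complex.I * u))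
      hi₂ ?_ ?_ ?_ hs) hB₂
    · exact fun u => mul_nonneg (norm_nonneg _) (hM0 u)
    · exact Complex.norm_I
    · intro u hu
      have h1 : Complex.I * (u * Complex.I) = -u := by
        rw [mul_left_comm, Complex.I_mul_I]; simp
      rw [h1, norm_mul, mul_comm]
      gcongr
      refine (hM₁ _).trans (hM (Set.mem_Ici.2 (abs_nonneg _)) (Set.mem_Ici.2 (abs_nonneg _)) ?_)
      refine (Complex.abs_im_le_norm _).trans ?_
      rw [norm_mul, norm_mul, ← neg_mul, ← Complex.ofReal_neg, Complex.norm_exp_ofReal_mul_I]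
      simp
  rcases eq_or_ne z 0 with rfl | hz
  · have := (norm_nonneg _).trans (hlow 0 0 le_rfl)
    simpa using this
  have harg0 : 0 ≤ z.arg := Complex.arg_nonneg_iff.2 him
  rcases harg0.eq_or_lt with h0 | hpos
  · have hz' : z = (‖z‖ : ℂ) := by
      conv_lhs => rw [← Complex.norm_mul_exp_arg_mul_I z]
      simp [← h0]
    have := hlow 0 ‖z‖ (norm_nonneg _)
    simp only [Complex.ofReal_zero, zero_mul, neg_zero, Complex.exp_zero, one_mul, mul_one,
      ← hz'] at this
    exact this
  have hzb : z.arg ≤ Real.pi / 2 := Complex.arg_le_pi_div_two_iff.2 (Or.inl hre)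
  have hsector : ∀ a : ℝ, 0 < a → a < z.arg →
      ‖∫ t in (0 : ℝ)..1, h₁ (Complex.exp (-(a * Complex.I)) * (t * z))
        * h₂ (Complex.I * (t * z)) * z‖ ≤ B := by
    intro a ha haz
    have hk : Differentiable ℂ
        (fun u => h₁ (Complex.exp (-(a * Complex.I)) * u) * h₂ (Complex.I * u)) := by
      fun_prop
    refine norm_le_of_sector (a := a) (C := C * C)
      (G := fun z => ∫ t in (0 : ℝ)..1, h₁ (Complex.exp (-(a * Complex.I)) * (t * z))
        * h₂ (Complex.I * (t * z)) * z)
      (fun w => (hasDerivAt_segment_integral hk w).differentiableAt) ha (haz.trans_le hzb)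
      ?_ (hlow a) (hup a) hz haz.le hzb
    refine norm_segment_integral_le_exp
      (k := fun u => h₁ (Complex.exp (-(a * Complex.I)) * u) * h₂ (Complex.I * u)) fun w => ?_
    have e1 : ‖Complex.exp (-(a * Complex.I)) * w‖ = ‖w‖ := by
      rw [norm_mul, ← neg_mul, ← Complex.ofReal_neg, Complex.norm_exp_ofReal_mul_I, one_mul]
    have e2 : ‖Complex.I * w‖ = ‖w‖ := by simp
    rw [norm_mul]
    calc _ ≤ (C * Real.exp (‖w‖ ^ 2)) * (C * Real.exp (‖w‖ ^ 2)) := by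
          gcongr
          · simpa only [e1] using hC₁ (Complex.exp (-(a * Complex.I)) * w)
          · simpa only [e2] using hC₂ (Complex.I * w)
      _ = _ := by rw [two_mul, Real.exp_add]; ring
  have hcont : Continuous fun a : ℝ =>
      ∫ t in (0 : ℝ)..1, h₁ (Complex.exp (-(a * Complex.I)) * (t * z))
        * h₂ (Complex.I * (t * z)) * z := by
    have := hd₁.continuous
    have := hd₂.continuous
    apply intervalIntegral.continuous_parametric_intervalIntegral_of_continuous'
    fun_prop
  have hlim := (hcont.norm.tendsto 0).mono_left (nhdsWithin_le_nhds (s := Set.Ioi 0))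
  have := le_of_tendsto hlim (b := B) (by
    filter_upwards [Ioo_mem_nhdsGT hpos] with a ha
    exact hsector a ha.1 ha.2)
  simpa using this

/-- An entire function of order two which is controlled by a radially increasing function of the
imaginary part vanishes if its product with that function is integrable on the real line. -/
theorem entire_eq_zero_of_integrable_mul {h : ℂ → ℂ} (hd : Differentiable ℂ h) {C : ℝ}
    (hC : ∀ z, ‖h z‖ ≤ C * Real.exp (‖z‖ ^ 2)) {M : ℝ → ℝ} (hM : MonotoneOn M (Set.Ici 0))
    (hhM : ∀ z, ‖h z‖ ≤ M |z.im|) (hi : Integrable fun s : ℝ => ‖h s‖ * M |s|) (z : ℂ) :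
    h z = 0 := by
  have hdn : Differentiable ℂ fun z => h (-z) := by fun_prop
  have hCn : ∀ z, ‖h (-z)‖ ≤ C * Real.exp (‖z‖ ^ 2) := fun z => by simpa using hC (-z)
  have hMn : ∀ z, ‖h (-z)‖ ≤ M |z.im| := fun z => by simpa using hhM (-z)
  have hin : Integrable fun s : ℝ => ‖h (-s)‖ * M |s| := by simpa using hi.comp_neg
  have hin' : Integrable fun s : ℝ => ‖h (- -s)‖ * M |s| := by simpa using hi
  have hBn : ∫ s : ℝ, ‖h (-s)‖ * M |s| ≤ ∫ s : ℝ, ‖h s‖ * M |s| := by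
    have := integral_neg_eq_self (fun s : ℝ => ‖h s‖ * M |s|) volume
    simp only [Complex.ofReal_neg, abs_neg] at this
    exact this.le
  have hBn' : ∫ s : ℝ, ‖h (- -s)‖ * M |s| ≤ ∫ s : ℝ, ‖h s‖ * M |s| := by simp
  have hk : Differentiable ℂ fun z => h z * h (Complex.I * z) := by fun_prop
  have hbound : ∀ z : ℂ, ‖∫ t in (0 : ℝ)..1, h (t * z) * h (Complex.I * (t * z)) * z‖ ≤
      ∫ s : ℝ, ‖h s‖ * M |s| := by
    intro z
    -- A rotation by a fourth root of unity carries each quadrant to the first; the two factors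
    -- become h or h(-·), possibly in the other order.
    have hrot : ∀ c w : ℂ, ‖c‖ = 1 → z = c * w →
        ‖∫ t in (0 : ℝ)..1, h (t * z) * h (Complex.I * (t * z)) * z‖ =
        ‖∫ t in (0 : ℝ)..1, h (c * (t * w)) * h (Complex.I * c * (t * w)) * w‖ := by
      rintro c w hc rfl
      have : ∀ t : ℝ, h (t * (c * w)) * h (Complex.I * (t * (c * w))) * (c * w) =
          c * (h (c * (t * w)) * h (Complex.I * c * (t * w)) * w) := by
        intro t
        rw [show (t : ℂ) * (c * w) = c * (t * w) by ring, ← mul_assoc Complex.I c]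
        ring
      simp_rw [this]
      rw [intervalIntegral.integral_const_mul, norm_mul, hc, one_mul]
    rcases le_total 0 z.re with hre | hre <;> rcases le_total 0 z.im with him | him
    · exact norm_segment_integral_mul_le_of_quadrant hd hd hC hC hM hhM hhM hi hin le_rfl hBn
        hre him
    · rw [hrot (-Complex.I) (Complex.I * z) (by simp) (by rw [← mul_assoc]; simp)]
      refine le_of_eq_of_le ?_ (norm_segment_integral_mul_le_of_quadrant (z := Complex.I * z)
        hd hdn hC hCn hM hhM hMn hi hin' le_rfl hBn' (by simpa using him) (by simpa using hre))
      congr 2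
      funext t
      rw [mul_neg, Complex.I_mul_I, neg_neg, one_mul, neg_mul, mul_comm (h (-_))]
    · rw [hrot Complex.I (-Complex.I * z) (by simp) (by rw [← mul_assoc]; simp)]
      refine le_of_eq_of_le ?_ (norm_segment_integral_mul_le_of_quadrant (z := -Complex.I * z)
        hdn hd hCn hC hM hMn hhM hin hin hBn hBn (by simpa using him) (by simpa using hre))
      congr 2
      funext t
      rw [Complex.I_mul_I, neg_one_mul, mul_comm (h _) (h (-_))]
    · rw [hrot (-1) (-z) (by simp) (by simp)]
      refine le_of_eq_of_le ?_ (norm_segment_integral_mul_le_of_quadrant (z := -z)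
        hdn hdn hCn hCn hM hMn hMn hin hin' hBn hBn' (by simpa using hre) (by simpa using him))
      congr 2
      funext t
      simp
  have hG : ∀ z, HasDerivAt
      (fun z : ℂ => ∫ t in (0 : ℝ)..1, h (t * z) * h (Complex.I * (t * z)) * z)
      (h z * h (Complex.I * z)) z := fun z => hasDerivAt_segment_integral hk z
  have hbd : Bornology.IsBounded (Set.range
      (fun z : ℂ => ∫ t in (0 : ℝ)..1, h (t * z) * h (Complex.I * (t * z)) * z)) :=
    isBounded_iff_forall_norm_le.2 ⟨_, by rintro _ ⟨z, rfl⟩; exact hbound z⟩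
  have hGd : Differentiable ℂ
      (fun z : ℂ => ∫ t in (0 : ℝ)..1, h (t * z) * h (Complex.I * (t * z)) * z) :=
    fun z => (hG z).differentiableAt
  obtain ⟨c, hc⟩ := hGd.exists_const_forall_eq_of_bounded hbd
  have hprod : ∀ z, h z * h (Complex.I * z) = 0 := by
    intro z
    have h1 := hG z
    rw [funext hc] at h1
    exact h1.unique (hasDerivAt_const z c)
  have hdI : Differentiable ℂ fun z => h (Complex.I * z) := by fun_prop
  rcases AnalyticOnNhd.eq_zero_or_eq_zero_of_mul_eq_zero (U := Set.univ)
    (hd.differentiableOn.analyticOnNhd isOpen_univ)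
    (hdI.differentiableOn.analyticOnNhd isOpen_univ) (fun z _ => hprod z)
    isPreconnected_univ with h0 | h0
  · exact h0 z (Set.mem_univ _)
  · have := h0 (-Complex.I * z) (Set.mem_univ _)
    rw [← mul_assoc] at this
    simpa using this

/-! ### Injectivity of the Fourier transform -/

open FourierTransform SchwartzMap in
/-- An integrable function whose Fourier transform vanishes is zero almost everywhere. -/
theorem ae_eq_zero_of_fourier_eq_zero {V F : Type*} [NormedAddCommGroup V] [InnerProductSpace ℝ V]
    [FiniteDimensional ℝ V] [MeasurableSpace V] [BorelSpace V] [NormedAddCommGroup F]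
    [NormedSpace ℂ F] [CompleteSpace F] {f : V → F} (hf : Integrable f)
    (h : ∀ ξ, 𝓕 f ξ = 0) : f =ᵐ[volume] 0 := by
  refine ae_eq_zero_of_integral_contDiff_smul_eq_zero hf.locallyIntegrable fun g hg hgs => ?_
  have hg1 : ContDiff ℝ (⊤ : ℕ∞) (fun x => (g x : ℂ)) := Complex.ofRealCLM.contDiff.comp hg
  have hg2 : HasCompactSupport (fun x => (g x : ℂ)) := hgs.comp_left Complex.ofReal_zero
  let S : 𝓢(V, ℂ) := hg2.toSchwartzMap hg1
  have hS : ∀ x, S x = g x := fun x => rfl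
  -- Multiplication formula: a test function is the transform of its inverse transform, so the
  -- transform can be moved onto f, where it vanishes.
  have h1 : ∫ x, (𝓕 (𝓕⁻ S : 𝓢(V, ℂ))) x • f x = ∫ x, (𝓕⁻ S : 𝓢(V, ℂ)) x • 𝓕 f x := by
    rw [SchwartzMap.fourier_coe]
    exact VectorFourier.integral_fourierIntegral_smul_eq_flip (L := innerₗ V)
      Real.continuous_fourierChar continuous_inner (𝓕⁻ S : 𝓢(V, ℂ)).integrable hf |>.trans (by
        simp only [flip_innerₗ]; rfl)
  rw [fourier_fourierInv_eq] at h1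
  simpa [h, hS] using h1

theorem angular_integral_eq_fourier {V F : Type*} [NormedAddCommGroup V] [InnerProductSpace ℝ V]
    [FiniteDimensional ℝ V] [MeasurableSpace V] [BorelSpace V] [NormedAddCommGroup F]
    [NormedSpace ℂ F] (f : V → F) (ξ : V) :
    FourierTransform.fourier f ξ =
      ∫ x, Complex.exp (-(Complex.I * (inner ℝ x ((2 * Real.pi) • ξ) : ℝ))) • f x := by
  rw [Real.fourier_eq']
  congr 1
  funext x
  congr 2
  rw [inner_smul_right]
  push_cast
  ring

theorem ae_eq_zero_of_angular_integral_eq_zero {V F : Type*} [NormedAddCommGroup V]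
    [InnerProductSpace ℝ V] [FiniteDimensional ℝ V] [MeasurableSpace V] [BorelSpace V]
    [NormedAddCommGroup F] [NormedSpace ℂ F] [CompleteSpace F] {f : V → F} (hf : Integrable f)
    (h : ∀ ξ, ∫ x, Complex.exp (-(Complex.I * (inner ℝ x ξ : ℝ))) • f x = 0) :
    f =ᵐ[volume] 0 :=
  ae_eq_zero_of_fourier_eq_zero hf fun ξ => by rw [angular_integral_eq_fourier, h]

/-! ### Gaussian averages and the one-variable theorem -/

section GaussianAverage

variable {X : Type*} [MeasurableSpace X] {μ : Measure X} {f : X → ℂ} {l : X → ℝ}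

theorem norm_cexp_gaussian (z : ℂ) (a : ℝ) :
    ‖Complex.exp (-(z - a) ^ 2 / 2)‖ = Real.exp (-(z.re - a) ^ 2 / 2) * Real.exp (z.im ^ 2 / 2) := by
  rw [Complex.norm_exp, ← Real.exp_add]
  congr 1
  simp [pow_two]
  ring

theorem norm_cexp_gaussian_le (z : ℂ) (a : ℝ) :
    ‖Complex.exp (-(z - a) ^ 2 / 2)‖ ≤ Real.exp (z.im ^ 2 / 2) := by
  rw [norm_cexp_gaussian]
  refine mul_le_of_le_one_left (Real.exp_pos _).le (Real.exp_le_one_iff.2 ?_)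
  nlinarith [sq_nonneg (z.re - a)]

theorem norm_sub_mul_cexp_gaussian_le (z : ℂ) (a : ℝ) :
    ‖(z - a) * Complex.exp (-(z - a) ^ 2 / 2)‖ ≤ (1 + |z.im|) * Real.exp (z.im ^ 2 / 2) := by
  rw [norm_mul, norm_cexp_gaussian, ← mul_assoc]
  gcongr
  have h1 : ‖z - a‖ ≤ |z.re - a| + |z.im| := by
    simpa using Complex.norm_le_abs_re_add_abs_im (z - a)
  have h2 : |z.re - a| * Real.exp (-(z.re - a) ^ 2 / 2) ≤ 1 := by
    rw [neg_div, Real.exp_neg, ← div_eq_mul_inv, div_le_one (Real.exp_pos _)]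
    have := Real.add_one_le_exp ((z.re - a) ^ 2 / 2)
    rw [← sq_abs] at this ⊢
    nlinarith [sq_nonneg (|z.re - a| - 1)]
  have h3 : Real.exp (-(z.re - a) ^ 2 / 2) ≤ 1 :=
    Real.exp_le_one_iff.2 (by nlinarith [sq_nonneg (z.re - a)])
  calc _ ≤ (|z.re - a| + |z.im|) * Real.exp (-(z.re - a) ^ 2 / 2) := by gcongr
    _ = |z.re - a| * Real.exp (-(z.re - a) ^ 2 / 2)
        + |z.im| * Real.exp (-(z.re - a) ^ 2 / 2) := by ring
    _ ≤ 1 + |z.im| * 1 := by gcongr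
    _ = _ := by ring

theorem integrable_mul_gaussian (hf : Integrable f μ) (hl : Measurable l) (z : ℂ) :
    Integrable (fun x => f x * Complex.exp (-(z - l x) ^ 2 / 2)) μ := by
  refine hf.mul_bdd (c := Real.exp (z.im ^ 2 / 2)) ?_ ?_
  · exact Measurable.aestronglyMeasurable (by fun_prop)
  · exact Filter.Eventually.of_forall fun x => norm_cexp_gaussian_le z (l x)

theorem differentiable_integral_mul_gaussian (hf : Integrable f μ) (hl : Measurable l) :
    Differentiable ℂ fun z : ℂ => ∫ x, f x * Complex.exp (-(z - l x) ^ 2 / 2) ∂μ := by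
  intro z₀
  have hmeas : ∀ z : ℂ, AEStronglyMeasurable (fun x => Complex.exp (-(z - l x) ^ 2 / 2)) μ :=
    fun z => Measurable.aestronglyMeasurable (by fun_prop)
  have hmeas' : AEStronglyMeasurable (fun x => (z₀ - l x)) μ :=
    Measurable.aestronglyMeasurable (by fun_prop)
  -- R bounds |Im z| on the unit ball around z₀, which makes the dominating function uniform there.
  set R := |z₀.im| + 1 with hR
  have := (hasDerivAt_integral_of_dominated_loc_of_deriv_le (μ := μ) (𝕜 := ℂ) (x₀ := z₀)
    (F := fun z x => f x * Complex.exp (-(z - l x) ^ 2 / 2))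
    (F' := fun z x => f x * (-((z - l x) * Complex.exp (-(z - l x) ^ 2 / 2))))
    (bound := fun x => ‖f x‖ * ((1 + R) * Real.exp (R ^ 2 / 2)))
    (s := Metric.ball z₀ 1) (Metric.ball_mem_nhds z₀ one_pos)
    (Filter.Eventually.of_forall fun z => hf.1.mul (hmeas z))
    (integrable_mul_gaussian hf hl z₀)
    (hf.1.mul (hmeas'.mul (hmeas z₀)).neg) ?_ (hf.norm.mul_const _) ?_).2
  · exact this.differentiableAt
  · refine Filter.Eventually.of_forall fun x z hz => ?_
    have hzR : |z.im| ≤ R := by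
      have h1 : |z.im - z₀.im| ≤ 1 := by
        rw [← Complex.sub_im]
        exact (Complex.abs_im_le_norm _).trans (mem_ball_iff_norm.1 hz).le
      have := abs_sub_abs_le_abs_sub z.im z₀.im
      linarith
    rw [norm_mul, norm_neg]
    refine mul_le_mul_of_nonneg_left ?_ (norm_nonneg _)
    refine (norm_sub_mul_cexp_gaussian_le z (l x)).trans ?_
    rw [← sq_abs z.im]
    gcongr
  · refine Filter.Eventually.of_forall fun x z _ => ?_
    refine HasDerivAt.const_mul (f x) ?_
    have h1 : HasDerivAt (fun z : ℂ => -(z - l x) ^ 2 / 2) (-(z - l x)) z := by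
      have := ((((hasDerivAt_id z).sub_const (l x : ℂ)).pow 2).neg).div_const 2
      convert! this using 1
      simp
      ring
    convert! h1.cexp using 1
    ring

theorem norm_integral_mul_gaussian_le (hf : Integrable f μ) (z : ℂ) :
    ‖∫ x, f x * Complex.exp (-(z - l x) ^ 2 / 2) ∂μ‖ ≤ (∫ x, ‖f x‖ ∂μ) * Real.exp (‖z‖ ^ 2) := by
  rw [← integral_mul_const]
  refine norm_integral_le_of_norm_le (hf.norm.mul_const _) (Filter.Eventually.of_forall fun x => ?_)
  rw [norm_mul]
  refine mul_le_mul_of_nonneg_left ((norm_cexp_gaussian_le z (l x)).trans ?_) (norm_nonneg _)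
  have h1 := Complex.abs_im_le_norm z
  have h2 : z.im ^ 2 ≤ ‖z‖ ^ 2 := by rw [← sq_abs]; gcongr
  gcongr
  nlinarith [sq_nonneg z.im]

theorem integrable_gaussian_mul_exp (t : ℝ) :
    Integrable fun r : ℝ => Real.exp (-r ^ 2 / 2) * Real.exp (|r| * t) := by
  have h : ∀ c : ℝ, Integrable fun r : ℝ => Real.exp (-r ^ 2 / 2 + c * r) := by
    intro c
    refine (integrable_cexp_quadratic (b := 1 / 2) (by simp) (c : ℂ) 0).norm.congr
      (Filter.Eventually.of_forall fun r => ?_)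
    simp only [Complex.norm_exp]
    congr 1
    simp [pow_two]
    ring
  refine ((h t).add (h (-t))).mono' (Continuous.aestronglyMeasurable (by fun_prop))
    (Filter.Eventually.of_forall fun r => ?_)
  rw [Real.norm_of_nonneg (by positivity), ← Real.exp_add]
  rcases abs_cases r with ⟨h, -⟩ | ⟨h, -⟩ <;> rw [h]
  · rw [mul_comm r t]
    exact le_add_of_nonneg_right (Real.exp_pos _).le
  · rw [neg_mul, mul_comm r t, ← neg_mul]
    exact le_add_of_nonneg_left (Real.exp_pos _).le

theorem norm_cexp_neg_I_mul (r : ℝ) : ‖Complex.exp (-(Complex.I * r))‖ = 1 := by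
  rw [mul_comm, ← neg_mul, ← Complex.ofReal_neg, Complex.norm_exp_ofReal_mul_I]

theorem continuous_phase_integral (hf : Integrable f μ) (hl : Measurable l) :
    Continuous fun r : ℝ => ∫ x, Complex.exp (-(Complex.I * (r * l x : ℝ))) * f x ∂μ := by
  refine continuous_of_dominated (bound := fun x => ‖f x‖) (fun r => ?_) (fun r => ?_) hf.norm ?_
  · exact AEStronglyMeasurable.mul (Measurable.aestronglyMeasurable (by fun_prop)) hf.1
  · refine Filter.Eventually.of_forall fun x => ?_
    rw [norm_mul, norm_cexp_neg_I_mul, one_mul]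
  · exact Filter.Eventually.of_forall fun x => by fun_prop

theorem norm_phase_integral_le (r : ℝ) :
    ‖∫ x, Complex.exp (-(Complex.I * (r * l x : ℝ))) * f x ∂μ‖ ≤ ∫ x, ‖f x‖ ∂μ := by
  refine (norm_integral_le_integral_norm _).trans_eq ?_
  congr 1
  funext x
  rw [norm_mul, norm_cexp_neg_I_mul, one_mul]

/-- The Gaussian is its own Fourier transform up to the factor √(2π); inserting this and applying
Fubini brings out the frequency function. -/
theorem integral_mul_gaussian_eq [SFinite μ] (hf : Integrable f μ) (hl : Measurable l) (z : ℂ) :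
    (Real.pi / (1 / 2 : ℂ)) ^ (1 / 2 : ℂ) * ∫ x, f x * Complex.exp (-(z - l x) ^ 2 / 2) ∂μ =
      ∫ r : ℝ, Complex.exp (Complex.I * z * r) * Complex.exp (-(1 / 2) * r ^ 2) *
        ∫ x, Complex.exp (-(Complex.I * (r * l x : ℝ))) * f x ∂μ := by
  have hre : 0 < (1 / 2 : ℂ).re := by simp
  have h1 : ∀ x, (Real.pi / (1 / 2 : ℂ)) ^ (1 / 2 : ℂ) *
      (f x * Complex.exp (-(z - l x) ^ 2 / 2)) =
      ∫ r : ℝ, f x * (Complex.exp (Complex.I * (z - l x) * r) * Complex.exp (-(1 / 2) * r ^ 2)) := by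
    intro x
    rw [integral_const_mul, fourierIntegral_gaussian hre]
    norm_num
    ring
  rw [← integral_const_mul]
  simp_rw [h1, ← integral_const_mul]
  rw [integral_integral_swap]
  · congr 1; funext r; congr 1; funext x
    rw [show Complex.I * (z - l x) * r = Complex.I * z * r + -(Complex.I * (r * l x : ℝ)) by
      push_cast; ring, Complex.exp_add]
    ring
  · have hint : Integrable fun r : ℝ =>
        Complex.exp (Complex.I * z * r) * Complex.exp (-(1 / 2) * r ^ 2) := by
      refine (integrable_cexp_quadratic hre (Complex.I * z) 0).congr
        (Filter.Eventually.of_forall fun r => ?_)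
      simp only [← Complex.exp_add]
      ring_nf
    have h2 := (hf.mul_prod hint).mul_bdd (c := 1)
      (g := fun p : X × ℝ => Complex.exp (-(Complex.I * (p.2 * l p.1 : ℝ))))
      (Measurable.aestronglyMeasurable (by fun_prop))
      (Filter.Eventually.of_forall fun p => (norm_cexp_neg_I_mul _).le)
    refine h2.congr (Filter.Eventually.of_forall fun p => ?_)
    simp only [Function.uncurry]
    rw [show Complex.I * (z - l p.1) * p.2 =
      Complex.I * z * p.2 + -(Complex.I * (p.2 * l p.1 : ℝ)) by push_cast; ring, Complex.exp_add]
    ring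

/-- After |s| ≤ |a| + |s - a|, completing the square leaves exp|ra| times a Gaussian centred at a +
r or a - r, according to the sign of r(s - a). The two centres give the factor 2. -/
theorem lintegral_gaussian_mul_exp_le (r a : ℝ) :
    ∫⁻ s : ℝ, ENNReal.ofReal (Real.exp (-(s - a) ^ 2 / 2)) *
        ENNReal.ofReal (Real.exp (-r ^ 2 / 2) * Real.exp (|r| * |s|)) ≤
      (2 * ∫⁻ s : ℝ, ENNReal.ofReal (Real.exp (-s ^ 2 / 2))) *
        ENNReal.ofReal (Real.exp |r * a|) := by
  have hpt : ∀ s : ℝ, Real.exp (-(s - a) ^ 2 / 2) * (Real.exp (-r ^ 2 / 2) * Real.exp (|r| * |s|)) ≤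
      (Real.exp (-(s - (a + r)) ^ 2 / 2) + Real.exp (-(s - (a - r)) ^ 2 / 2)) *
        Real.exp |r * a| := by
    intro s
    have h0 : |s| ≤ |a| + |s - a| := by
      simpa using abs_add_le a (s - a)
    have h1 : |r| * |s| ≤ |r * a| + |r * (s - a)| := by
      rw [abs_mul, abs_mul, ← mul_add]; gcongr
    rw [add_mul, ← Real.exp_add, ← Real.exp_add, ← Real.exp_add, ← Real.exp_add]
    rcases abs_cases (r * (s - a)) with ⟨h, -⟩ | ⟨h, -⟩ <;> rw [h] at h1
    · refine le_add_of_le_of_nonneg (Real.exp_le_exp.2 ?_) (Real.exp_pos _).le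
      nlinarith
    · refine le_add_of_nonneg_of_le (Real.exp_pos _).le (Real.exp_le_exp.2 ?_)
      nlinarith
  calc _ ≤ ∫⁻ s : ℝ, (ENNReal.ofReal (Real.exp (-(s - (a + r)) ^ 2 / 2)) +
          ENNReal.ofReal (Real.exp (-(s - (a - r)) ^ 2 / 2))) *
        ENNReal.ofReal (Real.exp |r * a|) := by
        refine lintegral_mono fun s => ?_
        rw [← ENNReal.ofReal_mul (Real.exp_pos _).le,
          ← ENNReal.ofReal_add (Real.exp_pos _).le (Real.exp_pos _).le,
          ← ENNReal.ofReal_mul (by positivity)]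
        exact ENNReal.ofReal_le_ofReal (hpt s)
    _ = _ := by
        rw [lintegral_mul_const _ (by fun_prop), lintegral_add_left (by fun_prop),
          lintegral_sub_right_eq_self (fun s : ℝ => ENNReal.ofReal (Real.exp (-s ^ 2 / 2))),
          lintegral_sub_right_eq_self (fun s : ℝ => ENNReal.ofReal (Real.exp (-s ^ 2 / 2))),
          two_mul]

theorem lintegral_gaussian_lt_top :
    ∫⁻ s : ℝ, ENNReal.ofReal (Real.exp (-s ^ 2 / 2)) < ⊤ := by
  have := (integrable_gaussian_mul_exp 0).lintegral_lt_top
  simpa using this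

/-- The Gaussian convolution of two weights satisfying an exponential pairing condition satisfies
the same condition. -/
theorem lintegral_gaussian_average_lt_top [SFinite μ] {F : X → ENNReal} (hF : Measurable F)
    {Φ : ℝ → ENNReal} (hΦ : Measurable Φ) (hl : Measurable l)
    (hfin : ∫⁻ r, Φ r * ∫⁻ x, F x * ENNReal.ofReal (Real.exp |r * l x|) ∂μ < ⊤) :
    ∫⁻ s : ℝ, (∫⁻ x, F x * ENNReal.ofReal (Real.exp (-(s - l x) ^ 2 / 2)) ∂μ) *
      ∫⁻ r, Φ r * ENNReal.ofReal (Real.exp (-r ^ 2 / 2) * Real.exp (|r| * |s|)) < ⊤ := by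
  set K : ENNReal := 2 * ∫⁻ s : ℝ, ENNReal.ofReal (Real.exp (-s ^ 2 / 2)) with hK
  have hKtop : K < ⊤ := ENNReal.mul_lt_top (by simp) lintegral_gaussian_lt_top
  calc _ = ∫⁻ s : ℝ, ∫⁻ r : ℝ, ∫⁻ x, Φ r * (F x *
        (ENNReal.ofReal (Real.exp (-(s - l x) ^ 2 / 2)) *
        ENNReal.ofReal (Real.exp (-r ^ 2 / 2) * Real.exp (|r| * |s|)))) ∂μ := by
        refine lintegral_congr fun s => ?_
        rw [← lintegral_const_mul _ (by fun_prop)]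
        refine lintegral_congr fun r => ?_
        rw [← lintegral_mul_const _ (by fun_prop)]
        refine lintegral_congr fun x => ?_
        ring
    _ = ∫⁻ r : ℝ, ∫⁻ x, (∫⁻ s : ℝ, Φ r * (F x *
        (ENNReal.ofReal (Real.exp (-(s - l x) ^ 2 / 2)) *
        ENNReal.ofReal (Real.exp (-r ^ 2 / 2) * Real.exp (|r| * |s|))))) ∂μ := by
        rw [lintegral_lintegral_swap]
        · refine lintegral_congr fun r => ?_
          rw [lintegral_lintegral_swap]
          exact Measurable.aemeasurable (by fun_prop)
        · refine Measurable.aemeasurable ?_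
          refine Measurable.lintegral_prod_right' (f := fun p : (ℝ × ℝ) × X => Φ p.1.2 * (F p.2 *
            (ENNReal.ofReal (Real.exp (-(p.1.1 - l p.2) ^ 2 / 2)) *
            ENNReal.ofReal (Real.exp (-p.1.2 ^ 2 / 2) * Real.exp (|p.1.2| * |p.1.1|))))) ?_
          fun_prop
    _ ≤ ∫⁻ r : ℝ, ∫⁻ x, Φ r * (F x * (K * ENNReal.ofReal (Real.exp |r * l x|))) ∂μ := by
        refine lintegral_mono fun r => lintegral_mono fun x => ?_
        simp only
        rw [lintegral_const_mul _ (by fun_prop), lintegral_const_mul _ (by fun_prop)]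
        gcongr
        exact lintegral_gaussian_mul_exp_le r (l x)
    _ = K * ∫⁻ r, Φ r * ∫⁻ x, F x * ENNReal.ofReal (Real.exp |r * l x|) ∂μ := by
        rw [← lintegral_const_mul' _ _ hKtop.ne]
        refine lintegral_congr fun r => ?_
        rw [lintegral_const_mul _ (by fun_prop), mul_left_comm,
          ← lintegral_const_mul K (by fun_prop)]
        congr 1
        refine lintegral_congr fun x => ?_
        ring
    _ < ⊤ := ENNReal.mul_lt_top hKtop hfin

/-- A one-dimensional uncertainty principle of Beurling type: if the frequency function
`r ↦ ∫ exp (-i r l) f` of `f` along `l` pairs finitely with `f` against `exp |r l|`, then it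
vanishes. -/
theorem phase_integral_eq_zero [SFinite μ] (hf : Integrable f μ) (hfm : Measurable f)
    (hl : Measurable l)
    (hfin : ∫⁻ r : ℝ, ‖∫ x, Complex.exp (-(Complex.I * (r * l x : ℝ))) * f x ∂μ‖ₑ *
      ∫⁻ x, ‖f x‖ₑ * ENNReal.ofReal (Real.exp |r * l x|) ∂μ < ⊤) (r : ℝ) :
    ∫ x, Complex.exp (-(Complex.I * (r * l x : ℝ))) * f x ∂μ = 0 := by
  set φ : ℝ → ℂ := fun r => ∫ x, Complex.exp (-(Complex.I * (r * l x : ℝ))) * f x ∂μ with hφ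
  have hφc : Continuous φ := continuous_phase_integral hf hl
  have hφb : ∀ r, ‖φ r‖ ≤ ∫ x, ‖f x‖ ∂μ := fun r => norm_phase_integral_le r
  set h : ℂ → ℂ := fun z => ∫ x, f x * Complex.exp (-(z - l x) ^ 2 / 2) ∂μ with hh
  set c : ℂ := (Real.pi / (1 / 2 : ℂ)) ^ (1 / 2 : ℂ) with hc
  have hc0 : c ≠ 0 := by
    rw [hc, Ne, Complex.cpow_eq_zero_iff]
    simp [Real.pi_ne_zero]
  have hrep : ∀ z, c * h z = ∫ r : ℝ, Complex.exp (Complex.I * z * r) *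
      Complex.exp (-(1 / 2) * r ^ 2) * φ r := fun z => integral_mul_gaussian_eq hf hl z
  have hnormg : ∀ r : ℝ, ‖Complex.exp (-(1 / 2) * (r : ℂ) ^ 2)‖ = Real.exp (-r ^ 2 / 2) := by
    intro r
    rw [Complex.norm_exp]
    congr 1
    simp [pow_two]
    ring
  have hint : ∀ t : ℝ, Integrable fun r : ℝ =>
      ‖φ r‖ * (Real.exp (-r ^ 2 / 2) * Real.exp (|r| * t)) := fun t =>
    (integrable_gaussian_mul_exp t).bdd_mul hφc.norm.aestronglyMeasurable
      (Filter.Eventually.of_forall fun r => by simpa using hφb r)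
  -- The bound obtained by taking norms inside the Fourier representation of h, since |exp(izr)| ≤
  -- exp(|r||Im z|).
  set M : ℝ → ℝ := fun t => ‖c‖⁻¹ * ∫ r : ℝ, ‖φ r‖ * (Real.exp (-r ^ 2 / 2) * Real.exp (|r| * t))
    with hM
  have hMmono : Monotone M := by
    intro t t' htt'
    refine mul_le_mul_of_nonneg_left (integral_mono (hint t) (hint t') fun r => ?_) (by positivity)
    simp only
    gcongr
  have hhM : ∀ z, ‖h z‖ ≤ M |z.im| := by
    intro z
    have h1 : ‖c‖ * ‖h z‖ ≤
        ∫ r : ℝ, ‖φ r‖ * (Real.exp (-r ^ 2 / 2) * Real.exp (|r| * |z.im|)) := by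
      rw [← norm_mul, hrep]
      refine norm_integral_le_of_norm_le (hint _) (Filter.Eventually.of_forall fun r => ?_)
      rw [norm_mul, norm_mul, hnormg, mul_comm, mul_comm (Real.exp (-r ^ 2 / 2))]
      gcongr
      rw [Complex.norm_exp, Real.exp_le_exp, ← abs_mul]
      have : (Complex.I * z * r).re = -(r * z.im) := by simp; ring
      rw [this]
      exact neg_le_abs _
    rw [hM]
    exact (le_inv_mul_iff₀ (norm_pos_iff.2 hc0)).2 h1
  have hd : Differentiable ℂ h := differentiable_integral_mul_gaussian hf hl
  have hi : Integrable fun s : ℝ => ‖h s‖ * M |s| := by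
    have hmeas : AEStronglyMeasurable (fun s : ℝ => ‖h s‖ * M |s|) volume :=
      ((hd.continuous.comp Complex.continuous_ofReal).norm.measurable.mul
        (hMmono.measurable.comp measurable_norm)).aestronglyMeasurable
    refine ⟨hmeas, ?_⟩
    have hkey := lintegral_gaussian_average_lt_top (μ := μ) (l := l) (F := fun x => ‖f x‖ₑ)
      (Φ := fun r => ‖φ r‖ₑ) hfm.enorm hφc.measurable.enorm hl hfin
    have hctop : ‖(‖c‖⁻¹ : ℝ)‖ₑ < ⊤ := enorm_lt_top
    refine lt_of_le_of_lt ?_ (ENNReal.mul_lt_top hctop hkey)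
    rw [← lintegral_const_mul' _ _ hctop.ne]
    refine lintegral_mono fun s => ?_
    simp only
    rw [enorm_mul, enorm_norm, hM, mul_left_comm]
    simp only [enorm_mul]
    gcongr
    · refine (enorm_integral_le_lintegral_enorm _).trans (lintegral_mono fun x => ?_)
      rw [enorm_mul]
      gcongr
      rw [← ofReal_norm, norm_cexp_gaussian]
      simp
    · refine (enorm_integral_le_lintegral_enorm _).trans (lintegral_mono fun r => ?_)
      rw [enorm_mul, enorm_norm, Real.enorm_of_nonneg (by positivity)]
  have hzero : ∀ z, h z = 0 := entire_eq_zero_of_integrable_mul hd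
    (norm_integral_mul_gaussian_le hf) (hMmono.monotoneOn _) hhM hi
  have hψint : Integrable fun r : ℝ => Complex.exp (-(1 / 2) * (r : ℂ) ^ 2) * φ r := by
    refine (hint 0).mono' (Continuous.aestronglyMeasurable (by fun_prop))
      (Filter.Eventually.of_forall fun r => ?_)
    rw [norm_mul, hnormg]
    simp [mul_comm]
  -- On the real line, h(-s) = 0 says that the Fourier integral of the Gaussian times φ vanishes.
  have hψ : (fun r : ℝ => Complex.exp (-(1 / 2) * (r : ℂ) ^ 2) * φ r) =ᵐ[volume] 0 := by
    refine ae_eq_zero_of_angular_integral_eq_zero hψint fun s => ?_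
    have h1 := hrep (-s)
    rw [hzero, mul_zero] at h1
    rw [h1]
    congr 1
    funext r
    rw [smul_eq_mul, mul_assoc]
    congr 2
    simp
    ring
  have hψ0 : (fun r : ℝ => Complex.exp (-(1 / 2) * (r : ℂ) ^ 2) * φ r) = 0 :=
    (Continuous.ae_eq_iff_eq volume (by fun_prop) continuous_zero).1 hψ
  exact (mul_eq_zero.1 (congrFun hψ0 r)).resolve_left (Complex.exp_ne_zero _)

end GaussianAverage

/-! ### Restriction to almost every ray -/

section Rays

open Module

/-- Integrals over rays: a function of finite integral has finite integral, with the polar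
weight, over almost every ray. -/
theorem ae_lintegral_ray_lt_top {E : Type*} [NormedAddCommGroup E] [NormedSpace ℝ E]
    [FiniteDimensional ℝ E] [Nontrivial E] [MeasurableSpace E] [BorelSpace E] (μ : Measure E)
    [μ.IsAddHaarMeasure] {W : E → ENNReal} (hW : Measurable W) (hfin : ∫⁻ v, W v ∂μ < ⊤) :
    ∀ᵐ v ∂μ, 1 ≤ ‖v‖ → ‖v‖ ≤ 2 →
      ∫⁻ r : ℝ, ENNReal.ofReal (|r| ^ (finrank ℝ E - 1)) * W (r • v) < ⊤ := by
  set A : Set E := {v | 1 ≤ ‖v‖ ∧ ‖v‖ ≤ 2} with hA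
  have hAm : MeasurableSet A :=
    (measurableSet_le measurable_const measurable_norm).inter
      (measurableSet_le measurable_norm measurable_const)
  -- The dilation v ↦ r v has Jacobian factor |r|^(-dim), which leaves |r|⁻¹ of the polar weight.
  have hscale : ∀ r : ℝ, r ≠ 0 → ENNReal.ofReal (|r| ^ (finrank ℝ E - 1)) *
      ∫⁻ v, A.indicator 1 v * W (r • v) ∂μ =
      ∫⁻ v, ENNReal.ofReal |r|⁻¹ * (A.indicator 1 (r⁻¹ • v) * W v) ∂μ := by
    intro r hr
    have hr' : 0 < |r| := abs_pos.2 hr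
    have hm : Measurable fun v => A.indicator (1 : E → ENNReal) (r⁻¹ • v) * W v :=
      ((measurable_one.indicator hAm).comp (measurable_const_smul _)).mul hW
    have h1 : ∫⁻ v, A.indicator 1 v * W (r • v) ∂μ =
        ∫⁻ v, A.indicator 1 (r⁻¹ • v) * W v ∂(Measure.map (r • ·) μ) := by
      rw [lintegral_map hm (measurable_const_smul r)]
      simp [smul_smul, inv_mul_cancel₀ hr]
    rw [h1, Measure.map_addHaar_smul μ hr, lintegral_smul_measure, lintegral_const_mul _ hm,
      smul_eq_mul, ← mul_assoc, ← ENNReal.ofReal_mul (by positivity)]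
    congr 2
    obtain ⟨d, hd⟩ := Nat.exists_eq_succ_of_ne_zero (finrank_pos (R := ℝ) (M := E)).ne'
    rw [hd, abs_inv, abs_pow]
    simp only [Nat.succ_eq_add_one, Nat.add_sub_cancel]
    field_simp
    ring
  -- The constraint is ‖v‖/2 ≤ |r| ≤ ‖v‖: the integrand is at most 2/‖v‖ on an interval of length
  -- 2‖v‖.
  have hrad : ∀ v : E, ∫⁻ r : ℝ, ENNReal.ofReal |r|⁻¹ * A.indicator 1 (r⁻¹ • v) ≤ 4 := by
    intro v
    rcases eq_or_ne v 0 with rfl | hv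
    · simp [hA]
    have hv' : 0 < ‖v‖ := norm_pos_iff.2 hv
    calc ∫⁻ r : ℝ, ENNReal.ofReal |r|⁻¹ * A.indicator 1 (r⁻¹ • v)
        ≤ ∫⁻ r : ℝ, (Set.Icc (-‖v‖) ‖v‖).indicator (fun _ => ENNReal.ofReal (2 / ‖v‖)) r := by
          refine lintegral_mono fun r => ?_
          by_cases hr : r⁻¹ • v ∈ A
          · have h1 := hr.1
            have h2 := hr.2
            rw [norm_smul, norm_inv, Real.norm_eq_abs] at h1 h2
            have hr0 : 0 < |r| := by
              rcases eq_or_ne r 0 with rfl | h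
              · norm_num at h1
              · exact abs_pos.2 h
            have h3 : |r| ≤ ‖v‖ := by
              rw [inv_mul_eq_div, le_div_iff₀ hr0] at h1
              linarith
            rw [Set.indicator_of_mem hr, Set.indicator_of_mem (Set.mem_Icc.2 (abs_le.1 h3))]
            simp only [Pi.one_apply, mul_one]
            exact ENNReal.ofReal_le_ofReal ((le_div_iff₀ hv').2 h2)
          · simp [Set.indicator_of_notMem hr]
      _ = 4 := by
          rw [lintegral_indicator measurableSet_Icc, setLIntegral_const, Real.volume_Icc,
            ← ENNReal.ofReal_mul (by positivity)]
          rw [show 2 / ‖v‖ * (‖v‖ - -‖v‖) = 4 by field_simp; norm_num]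
          norm_num
  have hsm : Measurable fun p : ℝ × E => p.1⁻¹ • p.2 := by fun_prop
  have htot : ∫⁻ v, (A.indicator 1 v *
      ∫⁻ r : ℝ, ENNReal.ofReal (|r| ^ (finrank ℝ E - 1)) * W (r • v)) ∂μ < ⊤ := by
    calc _ = ∫⁻ v, (∫⁻ r : ℝ, ENNReal.ofReal (|r| ^ (finrank ℝ E - 1)) *
            (A.indicator 1 v * W (r • v))) ∂μ := by
          refine lintegral_congr fun v => ?_
          rw [← lintegral_const_mul _ (by fun_prop)]
          refine lintegral_congr fun r => ?_
          ring
      _ = ∫⁻ r : ℝ, ENNReal.ofReal (|r| ^ (finrank ℝ E - 1)) *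
            ∫⁻ v, A.indicator 1 v * W (r • v) ∂μ := by
          have hAi : Measurable (A.indicator (1 : E → ENNReal)) := measurable_one.indicator hAm
          rw [lintegral_lintegral_swap (Measurable.aemeasurable (by fun_prop))]
          refine lintegral_congr fun r => ?_
          rw [lintegral_const_mul _ (by fun_prop)]
      _ = ∫⁻ r : ℝ, ∫⁻ v, ENNReal.ofReal |r|⁻¹ * (A.indicator 1 (r⁻¹ • v) * W v) ∂μ := by
          refine lintegral_congr_ae ?_
          filter_upwards [compl_mem_ae_iff.2 (measure_singleton (0 : ℝ))] with r hr
          exact hscale r hr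
      _ = ∫⁻ v, (∫⁻ r : ℝ, ENNReal.ofReal |r|⁻¹ * A.indicator 1 (r⁻¹ • v)) * W v ∂μ := by
          have hAi : Measurable fun p : ℝ × E => A.indicator (1 : E → ENNReal) (p.1⁻¹ • p.2) :=
            (measurable_one.indicator hAm).comp hsm
          rw [lintegral_lintegral_swap (Measurable.aemeasurable (by fun_prop))]
          refine lintegral_congr fun v => ?_
          have : Measurable fun r : ℝ => A.indicator (1 : E → ENNReal) (r⁻¹ • v) :=
            hAi.comp (measurable_id.prodMk measurable_const)
          rw [← lintegral_mul_const _ (by fun_prop)]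
          simp_rw [mul_assoc]
      _ ≤ ∫⁻ v, 4 * W v ∂μ := lintegral_mono fun v => by gcongr; exact hrad v
      _ = 4 * ∫⁻ v, W v ∂μ := lintegral_const_mul _ hW
      _ < ⊤ := ENNReal.mul_lt_top (by simp) hfin
  have hmeas : Measurable fun v => A.indicator 1 v *
      ∫⁻ r : ℝ, ENNReal.ofReal (|r| ^ (finrank ℝ E - 1)) * W (r • v) := by
    refine (measurable_one.indicator hAm).mul ?_
    refine Measurable.lintegral_prod_right' (f := fun p : E × ℝ =>
      ENNReal.ofReal (|p.2| ^ (finrank ℝ E - 1)) * W (p.2 • p.1)) ?_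
    fun_prop
  filter_upwards [ae_lt_top hmeas htot.ne] with v hv h1 h2
  have hvA : v ∈ A := ⟨h1, h2⟩
  simpa [Set.indicator_of_mem hvA] using hv

end Rays

/-! ### From rays to Euclidean space, and vector values -/

section Euclidean

variable {E : Type*} [NormedAddCommGroup E] [InnerProductSpace ℝ E] [FiniteDimensional ℝ E]
  [MeasurableSpace E] [BorelSpace E] {f : E → ℂ}

theorem continuous_angular_integral (hf : Integrable f) :
    Continuous fun ξ : E => ∫ x, Complex.exp (-(Complex.I * (inner ℝ x ξ : ℝ))) * f x := by
  refine continuous_of_dominated (bound := fun x => ‖f x‖) (fun ξ => ?_) (fun r => ?_) hf.norm ?_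
  · exact AEStronglyMeasurable.mul (Continuous.aestronglyMeasurable (by fun_prop)) hf.1
  · refine Filter.Eventually.of_forall fun x => ?_
    rw [norm_mul, norm_cexp_neg_I_mul, one_mul]
  · exact Filter.Eventually.of_forall fun x => by fun_prop

/-- The polar weight |r|^d degenerates only at 0, and it can be dropped there: J increases with |r|
and is finite at some r₀ ≠ 0 unless φ vanishes, while φ is bounded. -/
theorem angular_integral_ray_eq_zero (hf : Integrable f) (hfm : Measurable f) (v : E) (d : ℕ)
    (hfin : ∫⁻ r : ℝ, ENNReal.ofReal (|r| ^ d) *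
      (‖∫ x, Complex.exp (-(Complex.I * (inner ℝ x (r • v) : ℝ))) * f x‖ₑ *
        ∫⁻ x, ‖f x‖ₑ * ENNReal.ofReal (Real.exp |inner ℝ x (r • v)|)) < ⊤) (r : ℝ) :
    ∫ x, Complex.exp (-(Complex.I * (inner ℝ x (r • v) : ℝ))) * f x = 0 := by
  have hl : Measurable fun x : E => (inner ℝ x v : ℝ) := by fun_prop
  simp_rw [inner_smul_right] at hfin ⊢
  set φ : ℝ → ℂ := fun r => ∫ x, Complex.exp (-(Complex.I * (r * inner ℝ x v : ℝ))) * f x with hφ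
  set J : ℝ → ENNReal := fun r => ∫⁻ x, ‖f x‖ₑ * ENNReal.ofReal (Real.exp |r * inner ℝ x v|)
    with hJ
  change ∫⁻ r, ENNReal.ofReal (|r| ^ d) * (‖φ r‖ₑ * J r) < ⊤ at hfin
  change φ r = 0
  have hφc : Continuous φ := continuous_phase_integral hf hl
  have hJm : Measurable J := by
    refine Measurable.lintegral_prod_right' (f := fun p : ℝ × E =>
      ‖f p.2‖ₑ * ENNReal.ofReal (Real.exp |p.1 * inner ℝ p.2 v|)) ?_
    fun_prop
  by_contra hr
  -- By continuity {φ ≠ 0} is open, hence of positive measure if nonempty, so it meets the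
  -- full-measure set where the integrand is finite.
  obtain ⟨r₀, hφ0, hr0, hr0fin⟩ : ∃ r₀, φ r₀ ≠ 0 ∧ r₀ ≠ 0 ∧
      ENNReal.ofReal (|r₀| ^ d) * (‖φ r₀‖ₑ * J r₀) < ⊤ := by
    by_contra! hcon
    have hopen : IsOpen {r | φ r ≠ 0} := isOpen_ne_fun hφc continuous_const
    have hpos : volume {r | φ r ≠ 0} ≠ 0 := (hopen.measure_pos volume ⟨r, hr⟩).ne'
    refine hpos ?_
    have hae := (ae_lt_top (by fun_prop) hfin.ne).and
      (compl_mem_ae_iff.2 (measure_singleton (0 : ℝ)))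
    refine measure_mono_null ?_ (ae_iff.1 hae)
    rintro s hs ⟨h1, h2⟩
    exact absurd h1 (not_lt.2 (hcon s hs h2))
  have hw0 : ENNReal.ofReal (|r₀| ^ d) ≠ 0 := by
    rw [Ne, ENNReal.ofReal_eq_zero, not_le]
    exact pow_pos (abs_pos.2 hr0) d
  have hJ0 : J r₀ < ⊤ := by
    refine lt_top_iff_ne_top.2 fun htop => hr0fin.ne ?_
    rw [htop, ENNReal.mul_top (enorm_ne_zero.2 hφ0), ENNReal.mul_top hw0]
  refine hr (phase_integral_eq_zero (l := fun x => inner ℝ x v) hf hfm hl ?_ r)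
  change ∫⁻ r, ‖φ r‖ₑ * J r < ⊤
  have hφb : ∀ r, ‖φ r‖ₑ ≤ ENNReal.ofReal (∫ x, ‖f x‖) := fun r => by
    rw [← ofReal_norm]
    exact ENNReal.ofReal_le_ofReal (norm_phase_integral_le r)
  -- For |r| ≤ |r₀| use the bound on φ and J r ≤ J r₀; for larger |r| the weight is at least |r₀|^d.
  calc ∫⁻ r, ‖φ r‖ₑ * J r
      ≤ ∫⁻ r, ((Set.Icc (-|r₀|) |r₀|).indicator
          (fun _ => ENNReal.ofReal (∫ x, ‖f x‖) * J r₀) r +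
          (ENNReal.ofReal (|r₀| ^ d))⁻¹ * (ENNReal.ofReal (|r| ^ d) * (‖φ r‖ₑ * J r))) := by
        refine lintegral_mono fun s => ?_
        rcases le_total |s| |r₀| with hs | hs
        · refine le_add_of_le_of_nonneg ?_ zero_le
          rw [Set.indicator_of_mem (Set.mem_Icc.2 (abs_le.1 hs))]
          gcongr
          · exact hφb s
          · refine lintegral_mono fun x => ?_
            simp only [abs_mul]
            gcongr
        · refine le_add_of_nonneg_of_le zero_le ?_
          rw [← mul_assoc]
          refine le_mul_of_one_le_left zero_le ?_
          rw [mul_comm, ← ENNReal.div_eq_inv_mul.trans (mul_comm _ _),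
            ENNReal.le_div_iff_mul_le (Or.inl hw0) (Or.inl ENNReal.ofReal_ne_top), one_mul]
          exact ENNReal.ofReal_le_ofReal (by gcongr)
    _ = ENNReal.ofReal (∫ x, ‖f x‖) * J r₀ * volume (Set.Icc (-|r₀|) |r₀|) +
          (ENNReal.ofReal (|r₀| ^ d))⁻¹ *
            ∫⁻ r, ENNReal.ofReal (|r| ^ d) * (‖φ r‖ₑ * J r) := by
        rw [lintegral_add_left (measurable_const.indicator measurableSet_Icc),
          lintegral_indicator measurableSet_Icc, setLIntegral_const,
          lintegral_const_mul' _ _ (ENNReal.inv_ne_top.2 hw0)]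
    _ < ⊤ := by
        refine ENNReal.add_lt_top.2 ⟨ENNReal.mul_lt_top (ENNReal.mul_lt_top (by simp) hJ0) ?_,
          ENNReal.mul_lt_top (ENNReal.inv_lt_top.2 (pos_iff_ne_zero.2 hw0)) hfin⟩
        simp

/-- The scalar Beurling–Hörmander theorem, in terms of the Fourier integral. -/
theorem angular_integral_eq_zero [Nontrivial E] (hf : Integrable f) (hfm : Measurable f)
    (hfin : ∫⁻ ξ : E, ‖∫ x, Complex.exp (-(Complex.I * (inner ℝ x ξ : ℝ))) * f x‖ₑ *
      ∫⁻ x, ‖f x‖ₑ * ENNReal.ofReal (Real.exp |inner ℝ x ξ|) < ⊤) (ξ : E) :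
    ∫ x, Complex.exp (-(Complex.I * (inner ℝ x ξ : ℝ))) * f x = 0 := by
  set g : E → ℂ := fun ξ => ∫ x, Complex.exp (-(Complex.I * (inner ℝ x ξ : ℝ))) * f x with hg
  have hgc : Continuous g := continuous_angular_integral hf
  have hJm : Measurable fun ξ : E =>
      ∫⁻ x, ‖f x‖ₑ * ENNReal.ofReal (Real.exp |inner ℝ x ξ|) := by
    refine Measurable.lintegral_prod_right' (f := fun p : E × E =>
      ‖f p.2‖ₑ * ENNReal.ofReal (Real.exp |inner ℝ p.2 p.1|)) ?_
    fun_prop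
  have hray := ae_lintegral_ray_lt_top volume (hgc.measurable.enorm.mul hJm) hfin
  -- For fixed r the exceptional set of v is both open and null, hence empty.
  have hannulus : ∀ (r : ℝ) (v : E), 1 < ‖v‖ → ‖v‖ < 2 → g (r • v) = 0 := by
    intro r
    have hopen : IsOpen {v : E | 1 < ‖v‖ ∧ ‖v‖ < 2 ∧ g (r • v) ≠ 0} :=
      (isOpen_lt continuous_const continuous_norm).inter
        ((isOpen_lt continuous_norm continuous_const).inter
          (isOpen_ne_fun (hgc.comp (continuous_const_smul r)) continuous_const))
    have hnull : volume {v : E | 1 < ‖v‖ ∧ ‖v‖ < 2 ∧ g (r • v) ≠ 0} = 0 := by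
      refine measure_mono_null ?_ (ae_iff.1 hray)
      rintro v ⟨h1, h2, h3⟩ hv
      exact h3 (angular_integral_ray_eq_zero hf hfm v _ (hv h1.le h2.le) r)
    have hempty := (hopen.measure_eq_zero_iff volume).1 hnull
    intro v h1 h2
    by_contra h3
    exact (Set.eq_empty_iff_forall_notMem.1 hempty v) ⟨h1, h2, h3⟩
  rcases eq_or_ne ξ 0 with rfl | hξ
  · obtain ⟨v, hv⟩ := exists_norm_eq E (show (0 : ℝ) ≤ 3 / 2 by norm_num)
    have := hannulus 0 v (by rw [hv]; norm_num) (by rw [hv]; norm_num)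
    rwa [zero_smul] at this
  · have hξ' : 0 < ‖ξ‖ := norm_pos_iff.2 hξ
    have hn : ‖((3 / 2) / ‖ξ‖) • ξ‖ = 3 / 2 := by
      rw [norm_smul, Real.norm_of_nonneg (by positivity)]
      field_simp
    have := hannulus (‖ξ‖ * (2 / 3)) (((3 / 2) / ‖ξ‖) • ξ) (by rw [hn]; norm_num)
      (by rw [hn]; norm_num)
    rwa [smul_smul, show ‖ξ‖ * (2 / 3) * (3 / 2 / ‖ξ‖) = 1 by field_simp, one_smul] at this

/-- Each scalar function ⟨w, f⟩ inherits the hypothesis with factor ‖w‖², and its Fourier integral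
is ⟨w, ·⟩ of that of f. -/
theorem beurling_hormander [Nontrivial E] {H : Type*} [NormedAddCommGroup H]
    [InnerProductSpace ℂ H] [CompleteSpace H] {f : E → H} (hf : Integrable f)
    (hfin : ∫⁻ ξ : E, ‖∫ x, Complex.exp (-(Complex.I * (inner ℝ x ξ : ℝ))) • f x‖ₑ *
      ∫⁻ x, ‖f x‖ₑ * ENNReal.ofReal (Real.exp |inner ℝ x ξ|) < ⊤) :
    f =ᵐ[volume] 0 := by
  wlog hfm : StronglyMeasurable f generalizing f
  · obtain ⟨f', hf'm, hff'⟩ := hf.1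
    refine hff'.trans (this (hf.congr hff') ?_ hf'm)
    refine lt_of_eq_of_lt (lintegral_congr fun ξ => ?_) hfin
    refine congrArg₂ (fun a b => ‖a‖ₑ * b) ?_ ?_
    · refine integral_congr_ae ?_
      filter_upwards [hff'] with x hx
      rw [hx]
    · refine lintegral_congr_ae ?_
      filter_upwards [hff'] with x hx
      rw [hx]
  refine ae_eq_zero_of_angular_integral_eq_zero hf fun ξ => ?_
  refine ext_inner_left ℂ fun w => ?_
  have hphase : ∀ ξ, Integrable fun x => Complex.exp (-(Complex.I * (inner ℝ x ξ : ℝ))) • f x :=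
    fun ξ => hf.bdd_smul 1 (Continuous.aestronglyMeasurable (by fun_prop))
      (Filter.Eventually.of_forall fun x => (norm_cexp_neg_I_mul _).le)
  have hinner : ∀ ξ, ∫ x, Complex.exp (-(Complex.I * (inner ℝ x ξ : ℝ))) * inner ℂ w (f x) =
      inner ℂ w (∫ x, Complex.exp (-(Complex.I * (inner ℝ x ξ : ℝ))) • f x) := by
    intro ξ
    rw [← integral_inner (hphase ξ)]
    simp_rw [inner_smul_right]
  rw [inner_zero_right, ← hinner]
  have hw : ∀ y : H, ‖inner ℂ w y‖ₑ ≤ ‖w‖ₑ * ‖y‖ₑ := fun y => by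
    rw [← ofReal_norm, ← ofReal_norm, ← ofReal_norm, ← ENNReal.ofReal_mul (norm_nonneg _)]
    exact ENNReal.ofReal_le_ofReal (norm_inner_le_norm _ _)
  refine angular_integral_eq_zero (hf.const_inner w)
    (stronglyMeasurable_const.inner hfm).measurable ?_ ξ
  have htop : ‖w‖ₑ * ‖w‖ₑ < ⊤ := ENNReal.mul_lt_top enorm_lt_top enorm_lt_top
  refine lt_of_le_of_lt ?_ (ENNReal.mul_lt_top htop hfin)
  rw [← lintegral_const_mul' _ _ htop.ne]
  refine lintegral_mono fun ξ => ?_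
  simp only
  rw [hinner, mul_mul_mul_comm, ← lintegral_const_mul' ‖w‖ₑ _ enorm_lt_top.ne]
  refine mul_le_mul' (hw _) (lintegral_mono fun x => ?_)
  simp only
  rw [← mul_assoc]
  gcongr
  exact hw _

end Euclidean

/-! ### The two uncertainty principles -/

theorem lemma2p1 {n : ℕ} (hn : 0 < n)
    {H : Type*} [NormedAddCommGroup H] [InnerProductSpace ℂ H] [CompleteSpace H]
    (f : EuclideanSpace ℝ (Fin n) → H)
    (hf1 : MemLp f 1 volume) (hf2 : MemLp f 2 volume) :
    ((∫⁻ ξ, ∫⁻ x, ‖f x‖ₑ * ‖angularFourier f ξ‖ₑ *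
          ENNReal.ofReal (Real.exp |inner ℝ x ξ|)) < ⊤ →
        f =ᵐ[volume] 0) ∧
    (∀ p q α β : ℝ, 1 < p → p < 2 → 1 / p + 1 / q = 1 → 0 < α → 0 < β → 1 < α * β →
        (∫⁻ x, ‖f x‖ₑ * ENNReal.ofReal (Real.exp (α ^ p * ‖x‖ ^ p / p))) +
          (∫⁻ ξ, ‖angularFourier f ξ‖ₑ *
            ENNReal.ofReal (Real.exp (β ^ q * ‖ξ‖ ^ q / q))) < ⊤ →
        f =ᵐ[volume] 0) := by
  have hbeurling : (∫⁻ ξ, ∫⁻ x, ‖f x‖ₑ * ‖angularFourier f ξ‖ₑ *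
      ENNReal.ofReal (Real.exp |inner ℝ x ξ|)) < ⊤ → f =ᵐ[volume] 0 := by
    intro hfin
    -- Positive dimension is essential: on a one-point space every f satisfies the hypothesis.
    have : Nonempty (Fin n) := ⟨⟨0, hn⟩⟩
    have hc : 0 < (2 * Real.pi) ^ (-(n : ℝ) / 2) := Real.rpow_pos_of_pos (by positivity) _
    have hc0 : ‖(2 * Real.pi) ^ (-(n : ℝ) / 2)‖ₑ ≠ 0 := enorm_ne_zero.2 hc.ne'
    refine beurling_hormander (memLp_one_iff_integrable.1 hf1) ?_
    refine lt_of_eq_of_lt ?_ (ENNReal.mul_lt_top (ENNReal.inv_lt_top.2 (pos_iff_ne_zero.2 hc0)) hfin)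
    rw [← lintegral_const_mul' _ _ (ENNReal.inv_ne_top.2 hc0)]
    refine lintegral_congr fun ξ => ?_
    simp_rw [mul_right_comm _ ‖angularFourier f ξ‖ₑ]
    rw [lintegral_mul_const' _ _ enorm_ne_top, mul_comm (lintegral _ _), ← mul_assoc]
    congr 1
    rw [angularFourier, enorm_smul, ← mul_assoc, ENNReal.inv_mul_cancel hc0 enorm_ne_top, one_mul]
  refine ⟨hbeurling, fun p q α β hp1 hp2 hpq hα hβ hαβ hfin => hbeurling ?_⟩
  obtain ⟨hfin1, hfin2⟩ := ENNReal.add_lt_top.1 hfin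
  have hconj : p.HolderConjugate q :=
    Real.holderConjugate_iff.2 ⟨hp1, by simpa only [one_div] using hpq⟩
  have hyoung : ∀ x ξ : EuclideanSpace ℝ (Fin n),
      |inner ℝ x ξ| ≤ α ^ p * ‖x‖ ^ p / p + β ^ q * ‖ξ‖ ^ q / q := by
    intro x ξ
    calc |inner ℝ x ξ| ≤ ‖x‖ * ‖ξ‖ := abs_real_inner_le_norm x ξ
      _ ≤ (α * β) * (‖x‖ * ‖ξ‖) := le_mul_of_one_le_left (by positivity) hαβ.le
      _ = (α * ‖x‖) * (β * ‖ξ‖) := by ring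
      _ ≤ (α * ‖x‖) ^ p / p + (β * ‖ξ‖) ^ q / q :=
          Real.young_inequality_of_nonneg (by positivity) (by positivity) hconj
      _ = _ := by
          rw [Real.mul_rpow hα.le (norm_nonneg _), Real.mul_rpow hβ.le (norm_nonneg _)]
  refine lt_of_le_of_lt ?_ (ENNReal.mul_lt_top hfin1 hfin2)
  rw [← lintegral_const_mul' _ _ hfin1.ne]
  refine lintegral_mono fun ξ => ?_
  simp only
  rw [← lintegral_mul_const' _ _ (ENNReal.mul_ne_top enorm_ne_top ENNReal.ofReal_ne_top)]
  refine lintegral_mono fun x => ?_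
  simp only
  rw [mul_mul_mul_comm, ← ENNReal.ofReal_mul (Real.exp_pos _).le, ← Real.exp_add]
  gcongr
  exact hyoung x ξ
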